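/- Let $\mathcal{E}$ be a finite-dimensional Euclidean Jordan algebra, i.e. a finite-dimensional real inner product space with a bilinear product $\circ$ having an identity element $e$ and satisfying $x\circ y=y\circ x$, $x\circ(x^2\circ y)=x^2\circ(x\circ y)$ and $\langle z\circ x,y\rangle=\langle z,x\circ y\rangle$ for all $x,y,z\in\mathcal{E}$, where $x^2=x\circ x$. Let $r$ be its rank, the maximal number of nonzero idempotents $v_i$ (that is, $v_i\circ v_i=v_i$) which are pairwise orthogonal ($v_i\circ v_j=0$ for $i\neq j$), and let $\mathbb{R}^r_{\downarrow}=\{u\in\mathbb{R}^r: u_1\ge\cdots\ge u_r\}$. For every $x\in\mathcal{E}$ there is a unique $\lambda(x)\in\mathbb{R}^r_{\downarrow}$ such that $x=\sum_{i=1}^r\lambda_i(x)v_i$ for some nonzero pairwise orthogonal idempotents $v_1,\dots,v_r$ with $\sum_{i=1}^r v_i=e$. Put $\det(x)=\prod_{i=1}^r\lambda_i(x)$. Then the ordered eigenvalue map $\lambda:\mathcal{E}\to\mathbb{R}^r_{\downarrow}$ is semialgebraic: in linear coordinates on $\mathcal{E}$, its graph $\{(x,u): u=\lambda(x)\}\subseteq\mathcal{E}\times\mathbb{R}^r$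 is a finite union of sets of the form $\{z: p_i(z)=0\ (i=1,\dots,k),\ q_j(z)<0\ (j=1,\dots,\ell)\}$ with real polynomials $p_i,q_j$. Moreover, $\det:\mathcal{E}\to\mathbb{R}$ is a polynomial function, and $$\{(x,u)\in\mathcal{E}\times\mathbb{R}^r: u=\lambda(x)\}=\Big\{(x,u)\in\mathcal{E}\times\mathbb{R}^r_{\downarrow}:\ \det(x-te)=\prod_{i=1}^r(u_i-t)\ \text{ for all } t\in\mathbb{R}\Big\}.$$ -/

import Mathlib

open Module

/-- A subset of `ℝ^σ` is semialgebraic if it is a finite union of sets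
`{x | p x = 0 for all p ∈ P, q x < 0 for all q ∈ Q}`, with `P`, `Q` finite sets of real
polynomials. -/
def IsSemialgebraicSet {σ : Type*} (S : Set (σ → ℝ)) : Prop :=
  ∃ C : Finset (Finset (MvPolynomial σ ℝ) × Finset (MvPolynomial σ ℝ)),
    S = ⋃ c ∈ C, {x : σ → ℝ | (∀ p ∈ c.1, MvPolynomial.eval x p = 0) ∧
      ∀ q ∈ c.2, MvPolynomial.eval x q < 0}

/-- A map `ℝ^σ → ℝ^τ` is semialgebraic if its graph, a subset of `ℝ^(σ ⊕ τ)`, is. -/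
def IsSemialgebraicFun {σ τ : Type*} (f : (σ → ℝ) → (τ → ℝ)) : Prop :=
  IsSemialgebraicSet {z : σ ⊕ τ → ℝ | (fun j => z (Sum.inr j)) = f (fun i => z (Sum.inl i))}

/-- A map from a finite-dimensional real vector space `E` to `ℝ^τ` is semialgebraic if it is so
in the linear coordinates of every basis of `E`. -/
def IsSemialgebraicMap {E τ : Type*} [AddCommGroup E] [Module ℝ E] [FiniteDimensional ℝ E]
    (f : E → τ → ℝ) : Prop :=
  ∀ (n : ℕ) (b : Basis (Fin n) ℝ E), IsSemialgebraicFun (fun c => f (b.equivFun.symm c))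

/-- A real function on a finite-dimensional real vector space `E` is polynomial if it is so
in the linear coordinates of every basis of `E`. -/
def IsPolynomialFun {E : Type*} [AddCommGroup E] [Module ℝ E] [FiniteDimensional ℝ E]
    (f : E → ℝ) : Prop :=
  ∀ (n : ℕ) (b : Basis (Fin n) ℝ E), ∃ P : MvPolynomial (Fin n) ℝ,
    ∀ c : Fin n → ℝ, f (b.equivFun.symm c) = MvPolynomial.eval c P

/-- A Euclidean Jordan algebra: a unital commutative nonassociative real algebra, with an inner
product, whose product satisfies the Jordan identity (`IsCommJordan`) and whose multiplication
operators are symmetric for the inner product. -/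
class EuclideanJordanAlgebra (E : Type*) [NonAssocCommRing E] [Module ℝ E] extends
    IsScalarTower ℝ E E, SMulCommClass ℝ E E, IsCommJordan E,
    toInnerCore : InnerProductSpace.Core ℝ E where
  inner_mul_comm : ∀ x y z : E, inner (z * x) y = inner z (x * y)

namespace EuclideanJordanAlgebra

/-- A family of nonzero, pairwise orthogonal idempotents. -/
structure IsOrthogonalIdempotents {E : Type*} [NonAssocCommRing E] {k : ℕ} (v : Fin k → E) :
    Prop where
  ne_zero : ∀ i, v i ≠ 0
  idem : ∀ i, v i * v i = v i
  ortho : ∀ i j, i ≠ j → v i * v j = 0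

/-- The rank of a Jordan algebra: the maximal number of nonzero, pairwise orthogonal
idempotents. -/
noncomputable def rank (E : Type*) [NonAssocCommRing E] : ℕ :=
  sSup {k : ℕ | ∃ v : Fin k → E, IsOrthogonalIdempotents v}

/-- The supremum defining the rank is a maximum in finite dimension. -/
theorem isGreatest_rank (E : Type*) [NonAssocCommRing E] [Module ℝ E] [FiniteDimensional ℝ E]
    [SMulCommClass ℝ E E] :
    IsGreatest {k : ℕ | ∃ v : Fin k → E, IsOrthogonalIdempotents v} (rank E) := by
  have hbdd : BddAbove {k : ℕ | ∃ v : Fin k → E, IsOrthogonalIdempotents v} := by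
    refine ⟨finrank ℝ E, ?_⟩
    rintro k ⟨v, hv⟩
    have hli : LinearIndependent ℝ v := by
      rw [Fintype.linearIndependent_iff]
      intro g hg i
      have h : v i * ∑ j, g j • v j = g i • v i := by
        rw [Finset.mul_sum, Finset.sum_eq_single i]
        · rw [mul_smul_comm, hv.idem]
        · intro j _ hj
          rw [mul_smul_comm, hv.ortho i j hj.symm, smul_zero]
        · simp
      rw [hg, mul_zero] at h
      exact (smul_eq_zero.mp h.symm).resolve_right (hv.ne_zero i)
    simpa using hli.fintype_card_le_finrank
  refine ⟨Nat.sSup_mem ⟨0, Fin.elim0, ?_, ?_, ?_⟩ hbdd, fun k hk => le_csSup hbdd hk⟩ <;>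
    exact fun i => i.elim0

/-- `u` is the vector of eigenvalues of `x` in nonincreasing order: `x = ∑ i, u i • v i` for some
Jordan frame `v`, that is, `r` nonzero, pairwise orthogonal idempotents with sum `1`, where `r` is
the rank. -/
def IsOrderedEigenvalues {E : Type*} [NonAssocCommRing E] [Module ℝ E] (x : E)
    (u : Fin (rank E) → ℝ) : Prop :=
  Antitone u ∧ ∃ v : Fin (rank E) → E,
    IsOrthogonalIdempotents v ∧ ∑ i, v i = 1 ∧ x = ∑ i, u i • v i

/-- The ordered eigenvalue map `λ`, sending `x` to its eigenvalues in nonincreasing order. -/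
noncomputable def eigenvalueMap {E : Type*} [NonAssocCommRing E] [Module ℝ E] (x : E) :
    Fin (rank E) → ℝ :=
  Classical.epsilon (IsOrderedEigenvalues x)

/-- The determinant: the product of the eigenvalues. -/
noncomputable def det {E : Type*} [NonAssocCommRing E] [Module ℝ E] (x : E) : ℝ :=
  ∏ i, eigenvalueMap x i

end EuclideanJordanAlgebra

/-! Everything rests on one monic polynomial `g` of degree at most `r` whose coefficients are
polynomials in the coordinates of `x` and which, on any frame, specializes to `∏ (X - u i)`
(`exists_polynomial_map_eq_prod`). Uniqueness of the ordered eigenvalues, polynomiality of `det` (up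
to sign the constant coefficient) and semialgebraicity of the graph (match coefficients, order the
roots) follow from it.

To get `g`: power associativity and self-adjointness of `L(x)` decompose every `x` over at most `r`
orthogonal idempotents with distinct eigenvalues, so `1, x, ..., x ^ r` are always dependent. Hence
the powers of the generic element are dependent over the field of rational functions, and Gauss's
lemma clears the denominators (`exists_monic_polyEval_eq_zero`). With distinct coefficients on a
frame, `g` must be the product; repeated ones follow by perturbation.

Existence of a full frame needs no splitting of idempotents: elements with `r` distinct eigenvalues
are dense, and by compactness the elements admitting a frame form a closed set. -/

namespace EuclideanJordanAlgebra

open Polynomial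

/-! ### Power associativity. -/

section Powers

variable {E : Type*} [NonAssocCommRing E] [Module ℝ E] [SMulCommClass ℝ E E]

/-- The value of a real polynomial at an element `x`, with powers `x ^ n = L(x) ^ n 1`. -/
noncomputable def polyEval (x : E) : ℝ[X] →ₗ[ℝ] E :=
  (LinearMap.applyₗ (1 : E)).comp (aeval (R := ℝ) (LinearMap.mulLeft ℝ x)).toLinearMap

theorem polyEval_apply (x : E) (p : ℝ[X]) :
    polyEval x p = aeval (LinearMap.mulLeft ℝ x) p 1 := rfl

theorem polyEval_one (x : E) : polyEval x 1 = 1 := by simp [polyEval_apply]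

theorem polyEval_X (x : E) : polyEval x X = x := by simp [polyEval_apply]

theorem polyEval_X_mul (x : E) (p : ℝ[X]) : polyEval x (X * p) = x * polyEval x p := by
  simp [polyEval_apply]

section Frame

variable [IsScalarTower ℝ E E]

/-- Polynomials are evaluated at `∑ i, u i • v i` through the coefficients `u i`. -/
theorem polyEval_sum_smul {k : ℕ} {v : Fin k → E} (hv : IsOrthogonalIdempotents v)
    (h1 : ∑ i, v i = 1) (u : Fin k → ℝ) (p : ℝ[X]) :
    polyEval (∑ i, u i • v i) p = ∑ i, p.eval (u i) • v i := by
  induction p using Polynomial.induction_on' with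
  | add p q hp hq => simp only [map_add, hp, hq, eval_add, add_smul, Finset.sum_add_distrib]
  | monomial n a =>
    rw [← smul_X_eq_monomial, map_smul]
    simp only [eval_smul, smul_eq_mul, eval_pow, eval_X, mul_smul, ← Finset.smul_sum]
    congr 1
    induction n with
    | zero => simp only [pow_zero, polyEval_one, one_smul, h1]
    | succ n ih =>
      rw [pow_succ', polyEval_X_mul, ih, Finset.sum_mul]
      refine Finset.sum_congr rfl fun i _ => ?_
      rw [Finset.mul_sum, Finset.sum_eq_single i]
      · rw [smul_mul_assoc, mul_smul_comm, hv.idem, smul_smul, pow_succ']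
      · intro j _ hj
        rw [smul_mul_assoc, mul_smul_comm, hv.ortho i j hj.symm, smul_zero, smul_zero]
      · simp

end Frame

variable [IsCommJordan E]

/-- The linearized Jordan identity, as a formula for `L((ab)d)`. -/
theorem mulLeft_mul_mul (a b d : E) :
    LinearMap.mulLeft ℝ (a * b * d) =
      LinearMap.mulLeft ℝ (a * d) * LinearMap.mulLeft ℝ b +
      LinearMap.mulLeft ℝ (b * d) * LinearMap.mulLeft ℝ a +
      LinearMap.mulLeft ℝ (a * b) * LinearMap.mulLeft ℝ d -
      LinearMap.mulLeft ℝ a * LinearMap.mulLeft ℝ d * LinearMap.mulLeft ℝ b -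
      LinearMap.mulLeft ℝ b * LinearMap.mulLeft ℝ d * LinearMap.mulLeft ℝ a := by
  ext z
  -- The linearized identity, doubled, is a cyclic sum of commutators in `a`, `b`, `z` applied to
  -- `d`; reading `z` as the argument turns it into the formula for `L((ab)d)`.
  have h := DFunLike.congr_fun (two_nsmul_lie_lmul_lmul_add_add_eq_zero a b z) d
  have h2 : ∀ y : E, 2 • y = 0 → y = 0 := fun y hy => by
    have h3 : (2 : ℝ) • y = 0 := by rw [two_smul, ← two_nsmul, hy]
    exact (smul_eq_zero.mp h3).resolve_left two_ne_zero
  have h4 : a * (b * z * d) - b * z * (a * d) + (b * (z * a * d) - z * a * (b * d)) +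
      (z * (a * b * d) - a * b * (z * d)) = 0 := h2 _ h
  simp only [LinearMap.mulLeft_apply, LinearMap.add_apply, LinearMap.sub_apply,
    Module.End.mul_apply]
  rw [mul_comm (b * z) d, mul_comm (z * a) d, mul_comm z (a * b * d), mul_comm z a,
    mul_comm (b * z) (a * d), mul_comm (a * z) (b * d), mul_comm z d] at h4
  rw [← sub_eq_zero, ← h4]
  abel

theorem commute_mulLeft_sq (x : E) :
    Commute (LinearMap.mulLeft ℝ (x * x)) (LinearMap.mulLeft ℝ x) := by
  ext y
  have h := IsCommJordan.lmul_comm_rmul_rmul x y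
  simp only [Module.End.mul_apply, LinearMap.mulLeft_apply]
  rw [mul_comm (x * x) (x * y), mul_comm (x * x) y, h]

/-- `mulLeft_mul_mul` with `a = x ^ n`, `b = d = x` writes `L(x ^ (n + 2))` through `L(x ^ (n +
1))`, `L(x ^ n)`, `L(x * x)` and `L(x)`. As `L(x * x)` occurs, commutation with it is carried along
in the two-step induction. -/
theorem commute_mulLeft_polyEval_X_pow (x : E) (n : ℕ) :
    Commute (LinearMap.mulLeft ℝ (polyEval x (X ^ n))) (LinearMap.mulLeft ℝ x) ∧
    Commute (LinearMap.mulLeft ℝ (polyEval x (X ^ n))) (LinearMap.mulLeft ℝ (x * x)) := by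
  induction n using Nat.strong_induction_on with
  | _ n ih =>
    match n with
    | 0 =>
      have h : LinearMap.mulLeft ℝ (1 : E) = 1 := by ext; simp
      rw [pow_zero, polyEval_one, h]
      exact ⟨Commute.one_left _, Commute.one_left _⟩
    | 1 =>
      rw [pow_one, polyEval_X]
      exact ⟨Commute.refl _, (commute_mulLeft_sq x).symm⟩
    | n + 2 =>
      have e1 : polyEval x (X ^ (n + 1)) = polyEval x (X ^ n) * x := by
        rw [pow_succ', polyEval_X_mul, mul_comm]
      have e : polyEval x (X ^ (n + 2)) = polyEval x (X ^ n) * x * x := by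
        rw [pow_succ', polyEval_X_mul, mul_comm, e1]
      obtain ⟨h1, h1'⟩ := ih n (by omega)
      obtain ⟨h2, h2'⟩ := ih (n + 1) (by omega)
      rw [e1] at h2 h2'
      have hs := commute_mulLeft_sq x
      have hx := Commute.refl (LinearMap.mulLeft ℝ x)
      rw [e, mulLeft_mul_mul]
      exact ⟨((((h2.mul_left hx).add_left (hs.mul_left h1)).add_left (h2.mul_left hx)).sub_left
          ((h1.mul_left hx).mul_left hx)).sub_left ((hx.mul_left hx).mul_left h1),
        ((((h2'.mul_left hs.symm).add_left ((Commute.refl _).mul_left h1')).add_left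
          (h2'.mul_left hs.symm)).sub_left
          ((h1'.mul_left hs.symm).mul_left hs.symm)).sub_left
          ((hs.symm.mul_left hs.symm).mul_left h1')⟩

variable [IsScalarTower ℝ E E]

theorem commute_mulLeft_polyEval (x : E) (p : ℝ[X]) :
    Commute (LinearMap.mulLeft ℝ (polyEval x p)) (LinearMap.mulLeft ℝ x) := by
  induction p using Polynomial.induction_on' with
  | add p q hp hq =>
    have h : LinearMap.mulLeft ℝ (polyEval x (p + q)) =
        LinearMap.mulLeft ℝ (polyEval x p) + LinearMap.mulLeft ℝ (polyEval x q) := by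
      ext y; simp [add_mul]
    rw [h]
    exact hp.add_left hq
  | monomial n a =>
    have h : LinearMap.mulLeft ℝ (polyEval x (monomial n a)) =
        a • LinearMap.mulLeft ℝ (polyEval x (X ^ n)) := by
      rw [← smul_X_eq_monomial, map_smul]
      ext y; exact smul_mul_assoc _ _ _
    rw [h]
    exact (commute_mulLeft_polyEval_X_pow x n).1.smul_left a

/-- Power associativity. -/
theorem polyEval_mul (x : E) (p q : ℝ[X]) :
    polyEval x (p * q) = polyEval x p * polyEval x q := by
  -- Applied to `1`, this commutation says `p(x) * q(x) = q(L(x)) p(x)`, which is `(qp)(L(x)) 1`.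
  have hc : Commute (LinearMap.mulLeft ℝ (polyEval x p)) (aeval (LinearMap.mulLeft ℝ x) q) := by
    induction q using Polynomial.induction_on' with
    | add q₁ q₂ h₁ h₂ => rw [map_add]; exact h₁.add_right h₂
    | monomial n a =>
      rw [aeval_monomial]
      exact Commute.mul_right (Algebra.commutes a _).symm ((commute_mulLeft_polyEval x p).pow_right n)
  have h := DFunLike.congr_fun hc.eq (1 : E)
  simp only [Module.End.mul_apply, LinearMap.mulLeft_apply, mul_one] at h
  rw [polyEval_apply x q, h, mul_comm p q, polyEval_apply, map_mul, Module.End.mul_apply]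
  rfl

end Powers

/-! ### Independence and completeness of orthogonal idempotents. -/

section Frames

variable {E : Type*} [NonAssocCommRing E] [Module ℝ E]

theorem IsOrthogonalIdempotents.linearIndependent [SMulCommClass ℝ E E] {k : ℕ} {v : Fin k → E}
    (hv : IsOrthogonalIdempotents v) : LinearIndependent ℝ v := by
  rw [Fintype.linearIndependent_iff]
  intro g hg i
  have h : v i * ∑ j, g j • v j = g i • v i := by
    rw [Finset.mul_sum, Finset.sum_eq_single i]
    · rw [mul_smul_comm, hv.idem]
    · intro j _ hj
      rw [mul_smul_comm, hv.ortho i j hj.symm, smul_zero]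
    · simp
  rw [hg, mul_zero] at h
  exact (smul_eq_zero.mp h.symm).resolve_right (hv.ne_zero i)

/-- A family of orthogonal idempotents of maximal size is complete. -/
theorem IsOrthogonalIdempotents.sum_eq_one [SMulCommClass ℝ E E] [FiniteDimensional ℝ E]
    {v : Fin (rank E) → E} (hv : IsOrthogonalIdempotents v) : ∑ i, v i = 1 := by
  by_contra hne
  have hs : ∀ i, v i * ∑ j, v j = v i := by
    intro i
    rw [Finset.mul_sum, Finset.sum_eq_single i]
    · exact hv.idem i
    · exact fun j _ hj => hv.ortho i j hj.symm
    · simp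
  have hss : (∑ j, v j) * ∑ j, v j = ∑ j, v j := by
    rw [Finset.sum_mul]; exact Finset.sum_congr rfl fun i _ => hs i
  -- A nonzero defect `1 - ∑ v j` is one more orthogonal idempotent, against the maximality of the
  -- rank.
  have hw : IsOrthogonalIdempotents (Fin.cons (1 - ∑ j, v j) v : Fin (rank E + 1) → E) := by
    refine ⟨fun i => ?_, fun i => ?_, fun i j => ?_⟩
    · refine Fin.cases ?_ (fun i => ?_) i
      · simpa using sub_ne_zero.mpr (Ne.symm hne)
      · simpa using hv.ne_zero i
    · refine Fin.cases ?_ (fun i => ?_) i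
      · simp [mul_sub, sub_mul, hss]
      · simpa using hv.idem i
    · refine Fin.cases ?_ (fun i => ?_) i <;> refine Fin.cases ?_ (fun j => ?_) j
      · simp
      · intro _
        rw [Fin.cons_zero, Fin.cons_succ, mul_comm, mul_sub, hs, mul_one, sub_self]
      · intro _
        rw [Fin.cons_zero, Fin.cons_succ, mul_sub, hs, mul_one, sub_self]
      · intro hij
        simpa using hv.ortho i j fun h => hij (by rw [h])
  have := (isGreatest_rank E).2 ⟨_, hw⟩
  omega

end Frames

/-! ### Spectral theorem with distinct eigenvalues, and powers of elements. -/

section Spectral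

variable {E : Type*} [NonAssocCommRing E] [Module ℝ E] [FiniteDimensional ℝ E]
  [EuclideanJordanAlgebra E]

/-- Multiplication by `x` is diagonalizable. -/
theorem exists_finset_polyEval_eq_zero (x : E) :
    ∃ S : Finset ℝ, ∀ p : ℝ[X], (∀ a ∈ S, p.eval a = 0) → polyEval x p = 0 := by
  let _ : NormedAddCommGroup E := InnerProductSpace.Core.toNormedAddCommGroup (𝕜 := ℝ)
  let _ : InnerProductSpace ℝ E := InnerProductSpace.ofCore (toInnerCore (E := E)).toCore
  have hT : (LinearMap.mulLeft ℝ x).IsSymmetric := by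
    intro y z
    have := inner_mul_comm x z y
    rw [mul_comm y x] at this
    exact this
  -- `S` is the spectrum of the self-adjoint `L(x)`: a polynomial vanishing there kills an
  -- eigenbasis.
  refine ⟨Finset.univ.image (hT.eigenvalues rfl), fun p hp => ?_⟩
  have h0 : aeval (LinearMap.mulLeft ℝ x) p = 0 := by
    refine (hT.eigenvectorBasis rfl).toBasis.ext fun i => ?_
    rw [OrthonormalBasis.coe_toBasis, Module.End.aeval_apply_of_hasEigenvector
      (hT.hasEigenvector_eigenvectorBasis rfl i)]
    have := hp _ (Finset.mem_image_of_mem _ (Finset.mem_univ i))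
    simp only [RCLike.ofReal_real_eq_id, id_eq]
    rw [this, zero_smul, LinearMap.zero_apply]
  rw [polyEval_apply, h0, LinearMap.zero_apply]

/-- The spectral theorem, with distinct eigenvalues. -/
theorem exists_strictAnti_eq_sum_smul (x : E) :
    ∃ (k : ℕ) (u : Fin k → ℝ) (v : Fin k → E), StrictAnti u ∧ IsOrthogonalIdempotents v ∧
      ∑ i, v i = 1 ∧ x = ∑ i, u i • v i := by
  classical
  obtain ⟨S, hS⟩ := exists_finset_polyEval_eq_zero x
  have hev : ∀ p q : ℝ[X], (∀ a ∈ S, p.eval a = q.eval a) → polyEval x p = polyEval x q := by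
    intro p q h
    rw [← sub_eq_zero, ← map_sub]
    exact hS _ fun a ha => by rw [eval_sub, h a ha, sub_self]
  -- Polynomials agreeing on `S` have the same value at `x`, so the Lagrange basis yields orthogonal
  -- idempotents `c a` with sum `1` and `∑ a • c a = x`.
  set l : ℝ → ℝ[X] := fun a => Lagrange.basis S id a with hl
  have hself : ∀ a ∈ S, (l a).eval a = 1 := fun a ha =>
    Lagrange.eval_basis_self (Set.injOn_id _) ha
  have hne : ∀ a b, b ∈ S → a ≠ b → (l a).eval b = 0 := fun a b hb hab =>
    Lagrange.eval_basis_of_ne (v := id) hab hb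
  set c : ℝ → E := fun a => polyEval x (l a) with hc
  have hcc : ∀ a ∈ S, c a * c a = c a := by
    intro a ha
    rw [hc, ← polyEval_mul]
    refine hev _ _ fun b hb => ?_
    rcases eq_or_ne a b with rfl | hab
    · simp [hself a ha]
    · simp [hne a b hb hab]
  have hcd : ∀ a b, a ≠ b → c a * c b = 0 := by
    intro a b hab
    rw [hc, ← polyEval_mul]
    refine hS _ fun d hd => ?_
    rcases eq_or_ne a d with rfl | had
    · simp [hne b a hd hab.symm]
    · simp [hne a d hd had]
  have hsum : ∀ f : ℝ → ℝ, ∀ d ∈ S, (∑ a ∈ S, f a • l a).eval d = f d := by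
    intro f d hd
    rw [eval_finsetSum, Finset.sum_eq_single d]
    · simp [hself d hd]
    · intro b _ hb
      simp [hne b d hd hb]
    · exact fun h => absurd hd h
  have hc1 : ∑ a ∈ S, c a = 1 := by
    rw [← polyEval_one x, ← map_sum]
    refine hev _ _ fun d hd => ?_
    simpa using hsum (fun _ => 1) d hd
  have hcx : ∑ a ∈ S, a • c a = x := by
    conv_rhs => rw [← polyEval_X x]
    simp only [hc, ← map_smul]
    rw [← map_sum]
    refine hev _ _ fun d hd => ?_
    simpa using hsum id d hd
  -- A point of `S` may give the zero idempotent; these are discarded, which changes neither sum.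
  set T := S.filter fun a => c a ≠ 0 with hT
  -- `Fin.rev` makes the increasing enumeration of `T` decreasing.
  have hrev : ∀ f : ℝ → E, ∑ i, f (T.orderEmbOfFin rfl (Fin.rev i)) = ∑ a ∈ T, f a := by
    intro f
    have h := Equiv.sum_comp Fin.revPerm fun i => f (T.orderEmbOfFin rfl i)
    simp only [Fin.revPerm_apply] at h
    rw [h]
    conv_rhs => rw [← Finset.image_orderEmbOfFin_univ T rfl]
    rw [Finset.sum_image (fun i _ j _ h => (T.orderEmbOfFin rfl).injective h)]
  have hmem : ∀ i, T.orderEmbOfFin rfl i ∈ T := fun i => Finset.orderEmbOfFin_mem T rfl i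
  refine ⟨T.card, fun i => T.orderEmbOfFin rfl (Fin.rev i),
    fun i => c (T.orderEmbOfFin rfl (Fin.rev i)), ?_, ⟨?_, ?_, ?_⟩, ?_, ?_⟩
  · intro i j hij
    exact (T.orderEmbOfFin rfl).strictMono (Fin.rev_lt_rev.mpr hij)
  · exact fun i => (Finset.mem_filter.mp (hmem _)).2
  · exact fun i => hcc _ (Finset.mem_filter.mp (hmem _)).1
  · intro i j hij
    exact hcd _ _ fun h => hij (Fin.rev_injective ((T.orderEmbOfFin rfl).injective h))
  · rw [hrev c, ← hc1]
    exact Finset.sum_filter_ne_zero S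
  · rw [hrev fun a => a • c a, ← hcx]
    refine (Finset.sum_filter_of_ne ?_).symm
    rintro a _ ha h
    exact ha (by rw [h, smul_zero])

/-- An element whose first `rank E` powers are independent has `rank E` distinct eigenvalues. -/
theorem exists_strictAnti_of_linearIndependent {x : E}
    (hx : LinearIndependent ℝ fun i : Fin (rank E) => polyEval x (X ^ (i : ℕ))) :
    ∃ (u : Fin (rank E) → ℝ) (v : Fin (rank E) → E), StrictAnti u ∧
      IsOrthogonalIdempotents v ∧ ∑ i, v i = 1 ∧ x = ∑ i, u i • v i := by
  obtain ⟨k, u, v, hu, hv, h1, hxe⟩ := exists_strictAnti_eq_sum_smul x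
  have hk : k ≤ rank E := (isGreatest_rank E).2 ⟨v, hv⟩
  have hr : rank E ≤ k := by
    have hmem : ∀ i : Fin (rank E), polyEval x (X ^ (i : ℕ)) ∈ Submodule.span ℝ (Set.range v) := by
      intro i
      rw [hxe, polyEval_sum_smul hv h1]
      exact Submodule.sum_mem _ fun j _ => Submodule.smul_mem _ _ (Submodule.subset_span ⟨j, rfl⟩)
    have hle : Submodule.span ℝ (Set.range fun i : Fin (rank E) => polyEval x (X ^ (i : ℕ))) ≤
        Submodule.span ℝ (Set.range v) :=
      Submodule.span_le.mpr (by rintro _ ⟨i, rfl⟩; exact hmem i)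
    have := Submodule.finrank_mono hle
    rw [finrank_span_eq_card hx, Fintype.card_fin] at this
    refine this.trans ((finrank_range_le_card v).trans (by simp))
  obtain rfl : k = rank E := le_antisymm hk hr
  exact ⟨u, v, hu, hv, h1, hxe⟩

/-- The powers `1, …, x ^ rank E` of an element `x` are dependent. -/
theorem not_linearIndependent_polyEval_X_pow (x : E) :
    ¬ LinearIndependent ℝ fun i : Fin (rank E + 1) => polyEval x (X ^ (i : ℕ)) := by
  intro hx
  obtain ⟨k, u, v, hu, hv, h1, hxe⟩ := exists_strictAnti_eq_sum_smul x
  have hk : k ≤ rank E := (isGreatest_rank E).2 ⟨v, hv⟩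
  rw [Fintype.linearIndependent_iff] at hx
  -- The relation is `∏ (X - u j)`, of degree `k ≤ rank E`: it kills `x`, yet its coefficient at `k`
  -- is `1`.
  have := hx (fun i => (∏ j, (X - C (u j)) : ℝ[X]).coeff i) ?_ ⟨k, by omega⟩
  · have hm : (∏ j, (X - C (u j)) : ℝ[X]).coeff k = 1 := by
      have h := (monic_prod_X_sub_C u Finset.univ).coeff_natDegree
      rwa [natDegree_finsetProd_X_sub_C_eq_card, Finset.card_fin] at h
    simp only [hm] at this
    exact one_ne_zero this
  · have h : (∏ j, (X - C (u j)) : ℝ[X]) =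
        ∑ i : Fin (rank E + 1), (∏ j, (X - C (u j)) : ℝ[X]).coeff i • X ^ (i : ℕ) := by
      rw [Fin.sum_univ_eq_sum_range
        (fun i => (∏ j, (X - C (u j)) : ℝ[X]).coeff i • (X ^ i : ℝ[X])) (rank E + 1)]
      conv_lhs => rw [as_sum_range' (∏ j, (X - C (u j)) : ℝ[X]) (rank E + 1) (by
        rw [natDegree_finsetProd_X_sub_C_eq_card, Finset.card_fin]; omega)]
      simp only [smul_X_eq_monomial]
    simp only [← map_smul]
    rw [← map_sum, ← h, hxe, polyEval_sum_smul hv h1]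
    refine Finset.sum_eq_zero fun i _ => ?_
    rw [eval_prod, Finset.prod_eq_zero (Finset.mem_univ i) (by simp), zero_smul]

/-- Some element has independent powers `1, …, x ^ (rank E - 1)`. -/
theorem exists_linearIndependent_polyEval_X_pow :
    ∃ x : E, LinearIndependent ℝ fun i : Fin (rank E) => polyEval x (X ^ (i : ℕ)) := by
  obtain ⟨v, hv⟩ := (isGreatest_rank E).1
  -- Distinct coefficients on a maximal family: a relation between powers becomes a Vandermonde
  -- system.
  refine ⟨∑ i : Fin (rank E), ((i : ℕ) : ℝ) • v i, ?_⟩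
  rw [Fintype.linearIndependent_iff]
  intro a ha
  simp only [← map_smul, ← map_sum] at ha
  rw [polyEval_sum_smul hv hv.sum_eq_one] at ha
  have h0 := Fintype.linearIndependent_iff.mp hv.linearIndependent _ ha
  have hinj : Function.Injective fun i : Fin (rank E) => ((i : ℕ) : ℝ) :=
    fun i j h => Fin.ext (Nat.cast_injective h)
  have hz := Matrix.eq_zero_of_forall_index_sum_mul_pow_eq_zero hinj (v := a) fun j => by
    have h := h0 j
    simp only [eval_finsetSum, eval_smul, eval_pow, eval_X, smul_eq_mul] at h
    exact h
  exact fun i => congrFun hz i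

end Spectral

end EuclideanJordanAlgebra

/-! ### Transfer of linear independence between generic and special points. -/

section MatrixLemmas

open scoped Matrix

/-- A right inverse encodes independence as a matrix identity, which can be specialized at points.
-/
theorem exists_matrix_of_mul_eq_one {K : Type*} [Field K] {k n : ℕ} {w : Fin k → Fin n → K}
    (hw : LinearIndependent K w) : ∃ B : Matrix (Fin n) (Fin k) K, Matrix.of w * B = 1 := by
  obtain ⟨f, hf⟩ := LinearMap.exists_leftInverse_of_injective (Matrix.of w).vecMulLinear
    (LinearMap.ker_eq_bot.mpr (Matrix.vecMul_injective_iff.mpr hw))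
  refine ⟨Matrix.of fun j i => f (Pi.single j 1) i, ?_⟩
  have hfa : ∀ y : Fin n → K, f y = y ᵥ* Matrix.of fun j i => f (Pi.single j 1) i := by
    intro y
    conv_lhs => rw [← Finset.univ_sum_single y]
    ext i
    simp only [map_sum, Finset.sum_apply, Matrix.vecMul, dotProduct, Matrix.of_apply]
    refine Finset.sum_congr rfl fun j _ => ?_
    have : Pi.single j (y j) = y j • (Pi.single j 1 : Fin n → K) := by
      rw [← Pi.single_smul, smul_eq_mul, mul_one]
    rw [this, map_smul, Pi.smul_apply, smul_eq_mul]
  ext i i'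
  have h := DFunLike.congr_fun hf (Pi.single i 1)
  rw [LinearMap.comp_apply, hfa, Matrix.vecMulLinear_apply, Matrix.vecMul_vecMul] at h
  rw [Matrix.single_one_vecMul] at h
  rw [Matrix.one_apply]
  refine (congrFun h i').trans ?_
  rw [LinearMap.id_apply, Pi.single_apply]
  exact if_congr eq_comm rfl rfl

/-- The scalar `s` leaves room for a common denominator. -/
theorem linearIndependent_of_mul_eq_smul_one {K : Type*} [Field K] {k n : ℕ}
    {w : Fin k → Fin n → K} {B : Matrix (Fin n) (Fin k) K} {s : K} (hs : s ≠ 0)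
    (h : Matrix.of w * B = s • (1 : Matrix (Fin k) (Fin k) K)) : LinearIndependent K w := by
  rw [show w = (Matrix.of w).row from rfl, ← Matrix.vecMul_injective_iff]
  intro a a' haa
  have h2 : a ᵥ* (Matrix.of w * B) = a' ᵥ* (Matrix.of w * B) := by
    rw [← Matrix.vecMul_vecMul, ← Matrix.vecMul_vecMul]
    exact congrArg (fun y => y ᵥ* B) haa
  rw [h, Matrix.vecMul_smul, Matrix.vecMul_smul, Matrix.vecMul_one, Matrix.vecMul_one] at h2
  exact smul_right_injective _ hs h2

open MvPolynomial in
/-- Pointwise independence of polynomial vectors is a nonempty Zariski open condition. -/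
theorem MvPolynomial.exists_ne_zero_linearIndependent_eval {σ : Type*} {k n : ℕ}
    {w : Fin k → Fin n → MvPolynomial σ ℝ} {c₀ : σ → ℝ}
    (h₀ : LinearIndependent ℝ fun i j => eval c₀ (w i j)) :
    ∃ D : MvPolynomial σ ℝ, D ≠ 0 ∧
      ∀ c, eval c D ≠ 0 → LinearIndependent ℝ fun i j => eval c (w i j) := by
  obtain ⟨B, hB⟩ := exists_matrix_of_mul_eq_one h₀
  have he : ∀ c, eval c (Matrix.of w * (B.map C : Matrix (Fin n) (Fin k) (MvPolynomial σ ℝ))).det =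
      ((Matrix.of fun i j => eval c (w i j)) * B).det := by
    intro c
    rw [RingHom.map_det]
    congr 1
    ext i j
    simp [Matrix.mul_apply]
  -- `B` is the right inverse at `c₀`, kept constant, so this determinant equals `1` at `c₀`.
  refine ⟨(Matrix.of w * (B.map C : Matrix (Fin n) (Fin k) (MvPolynomial σ ℝ))).det, fun h => ?_, fun c hc => ?_⟩
  · have := he c₀
    rw [hB, h, map_zero, Matrix.det_one] at this
    exact zero_ne_one this
  · rw [he] at hc
    refine linearIndependent_of_mul_eq_smul_one
      (B := B * ((Matrix.of fun i j => eval c (w i j)) * B)⁻¹) one_ne_zero ?_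
    rw [one_smul, ← Matrix.mul_assoc, Matrix.mul_nonsing_inv _ (isUnit_iff_ne_zero.mpr hc)]

open MvPolynomial in
/-- Polynomial vectors that are independent over the field of fractions are independent at some
point. -/
theorem MvPolynomial.exists_linearIndependent_eval {σ : Type*} {k n : ℕ}
    {w : Fin k → Fin n → MvPolynomial σ ℝ}
    (h : LinearIndependent (FractionRing (MvPolynomial σ ℝ)) fun i j =>
      algebraMap (MvPolynomial σ ℝ) (FractionRing (MvPolynomial σ ℝ)) (w i j)) :
    ∃ c, LinearIndependent ℝ fun i j => eval c (w i j) := by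
  obtain ⟨B, hB⟩ := exists_matrix_of_mul_eq_one h
  -- With `s` a common denominator of `B`, the identity holds over polynomials, and independence
  -- survives wherever `s` does not vanish.
  obtain ⟨s, hs⟩ := IsLocalization.exist_integer_multiples_of_finite
    (nonZeroDivisors (MvPolynomial σ ℝ)) fun p : Fin n × Fin k => B p.1 p.2
  choose B' hB' using hs
  have hinj := IsFractionRing.injective (MvPolynomial σ ℝ) (FractionRing (MvPolynomial σ ℝ))
  have hmul : Matrix.of w * (Matrix.of fun j i => B' (j, i)) =
      (s : MvPolynomial σ ℝ) • (1 : Matrix (Fin k) (Fin k) (MvPolynomial σ ℝ)) := by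
    ext1 i i'
    refine hinj ?_
    have h1 := congrFun (congrFun hB i) i'
    simp only [Matrix.mul_apply, Matrix.of_apply, Matrix.one_apply] at h1
    have hterm : ∀ x, algebraMap (MvPolynomial σ ℝ) (FractionRing (MvPolynomial σ ℝ)) (w i x) *
        algebraMap (MvPolynomial σ ℝ) (FractionRing (MvPolynomial σ ℝ)) (B' (x, i')) =
        algebraMap (MvPolynomial σ ℝ) (FractionRing (MvPolynomial σ ℝ)) s *
        (algebraMap (MvPolynomial σ ℝ) (FractionRing (MvPolynomial σ ℝ)) (w i x) * B x i') := by
      intro x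
      rw [hB', Algebra.smul_def, mul_left_comm]
    simp only [Matrix.mul_apply, Matrix.of_apply, map_sum, map_mul, Matrix.smul_apply,
      Matrix.one_apply, smul_eq_mul, hterm]
    rw [← Finset.mul_sum, h1]
    split_ifs <;> simp
  obtain ⟨c, hc⟩ : ∃ c, eval c (s : MvPolynomial σ ℝ) ≠ 0 := by
    by_contra! h0
    exact nonZeroDivisors.coe_ne_zero s (MvPolynomial.funext fun c => by rw [h0 c, map_zero])
  refine ⟨c, linearIndependent_of_mul_eq_smul_one
    (B := Matrix.of fun j i => eval c (B' (j, i))) hc ?_⟩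
  ext i i'
  have h1 := congrArg (eval c) (congrFun (congrFun hmul i) i')
  simpa [Matrix.mul_apply, Matrix.one_apply, apply_ite (eval c)] using h1

theorem Matrix.map_aeval {R S : Type*} [CommRing R] [CommRing S] {n : ℕ} (f : R →+* S)
    (M : Matrix (Fin n) (Fin n) R) (p : Polynomial R) :
    (Polynomial.aeval M p).map f = Polynomial.aeval (M.map f) (p.map f) := by
  refine Polynomial.map_aeval_eq_aeval_map (ψ := f.mapMatrix) (φ := f) ?_ p M
  ext a i j
  simp [Matrix.algebraMap_matrix_apply, apply_ite f]

end MatrixLemmas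

namespace EuclideanJordanAlgebra

open MvPolynomial

/-! ### The generic element and its specializations. -/

section Generic

variable {E : Type*} [NonAssocCommRing E] [Module ℝ E] {n : ℕ} (b : Basis (Fin n) ℝ E)

/-- The matrix of multiplication by the generic element `∑ i, X i • b i`. -/
noncomputable def genericMul [SMulCommClass ℝ E E] :
    Matrix (Fin n) (Fin n) (MvPolynomial (Fin n) ℝ) :=
  ∑ i, (X i : MvPolynomial (Fin n) ℝ) •
    (LinearMap.toMatrix b b (LinearMap.mulLeft ℝ (b i))).map C

/-- The coordinates of the identity, as constant polynomials. -/
noncomputable def genericOne : Fin n → MvPolynomial (Fin n) ℝ := fun j => C (b.equivFun 1 j)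

variable [SMulCommClass ℝ E E] [IsScalarTower ℝ E E]

theorem genericMul_map_eval (c : Fin n → ℝ) :
    (genericMul b).map (eval c) =
      LinearMap.toMatrix b b (LinearMap.mulLeft ℝ (b.equivFun.symm c)) := by
  have h : LinearMap.mulLeft ℝ (b.equivFun.symm c) = ∑ i, c i • LinearMap.mulLeft ℝ (b i) := by
    ext y
    simp [Basis.equivFun_symm_apply, Finset.sum_mul, smul_mul_assoc]
  rw [h, map_sum]
  ext i j
  simp [genericMul, Matrix.sum_apply]

/-- Evaluation of a polynomial at the generic element specializes to evaluation at each point. -/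
theorem eval_aeval_genericMul (c : Fin n → ℝ) (p : Polynomial (MvPolynomial (Fin n) ℝ)) :
    (fun j => eval c ((Polynomial.aeval (genericMul b) p).mulVec (genericOne b) j)) =
      b.equivFun (polyEval (b.equivFun.symm c) (p.map (eval c))) := by
  ext j
  rw [RingHom.map_mulVec, Matrix.map_aeval, genericMul_map_eval]
  have h : (eval c ∘ genericOne b) = b.equivFun 1 := by ext i; simp [genericOne]
  rw [h, polyEval_apply]
  have h2 := Polynomial.aeval_algHom_apply (LinearMap.toMatrixAlgEquiv b).toAlgHom
    (LinearMap.mulLeft ℝ (b.equivFun.symm c)) (p.map (eval c))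
  have h3 : Polynomial.aeval (LinearMap.toMatrix b b (LinearMap.mulLeft ℝ (b.equivFun.symm c)))
      (p.map (eval c)) = LinearMap.toMatrix b b (Polynomial.aeval
        (LinearMap.mulLeft ℝ (b.equivFun.symm c)) (p.map (eval c))) := h2
  rw [h3]
  generalize Polynomial.aeval (LinearMap.mulLeft ℝ (b.equivFun.symm c)) (p.map (eval c)) = T
  rw [Basis.equivFun_apply, Basis.equivFun_apply, LinearMap.toMatrix_mulVec_repr]

theorem linearIndependent_eval_genericPow_iff (c : Fin n → ℝ) (k : ℕ) :
    (LinearIndependent ℝ fun (i : Fin k) (j : Fin n) => eval c ((Polynomial.aeval (genericMul b)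
        (Polynomial.X ^ (i : ℕ) : Polynomial (MvPolynomial (Fin n) ℝ))).mulVec (genericOne b) j)) ↔
      LinearIndependent ℝ fun i : Fin k =>
        polyEval (b.equivFun.symm c) (Polynomial.X ^ (i : ℕ)) := by
  have h : (fun (i : Fin k) (j : Fin n) => eval c ((Polynomial.aeval (genericMul b)
      (Polynomial.X ^ (i : ℕ) : Polynomial (MvPolynomial (Fin n) ℝ))).mulVec (genericOne b) j)) =
      b.equivFun.toLinearMap ∘ fun i : Fin k =>
        polyEval (b.equivFun.symm c) (Polynomial.X ^ (i : ℕ)) := by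
    ext1 i
    rw [eval_aeval_genericMul, Polynomial.map_pow, Polynomial.map_X]
    rfl
  rw [h, (b.equivFun.toLinearMap).linearIndependent_iff b.equivFun.ker]

end Generic

/-! ### The generic annihilating polynomial. -/

section GenericEuclidean

variable {E : Type*} [NonAssocCommRing E] [Module ℝ E] [FiniteDimensional ℝ E]
  [EuclideanJordanAlgebra E] {n : ℕ} (b : Basis (Fin n) ℝ E)

/-- The elements with `rank E` distinct eigenvalues contain a nonempty Zariski open set. -/
theorem exists_ne_zero_linearIndependent :
    ∃ D : MvPolynomial (Fin n) ℝ, D ≠ 0 ∧ ∀ c, eval c D ≠ 0 →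
      LinearIndependent ℝ fun i : Fin (rank E) =>
        polyEval (b.equivFun.symm c) (Polynomial.X ^ (i : ℕ)) := by
  obtain ⟨x, hx⟩ := exists_linearIndependent_polyEval_X_pow (E := E)
  have h := (linearIndependent_eval_genericPow_iff b (b.equivFun x) (rank E)).mpr
    (by rwa [LinearEquiv.symm_apply_apply])
  obtain ⟨D, hD, hDc⟩ := MvPolynomial.exists_ne_zero_linearIndependent_eval h
  exact ⟨D, hD, fun c hc => (linearIndependent_eval_genericPow_iff b c (rank E)).mp (hDc c hc)⟩

/-- A monic polynomial of degree at most `rank E`, with coefficients polynomial in `x`, that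
annihilates every `x`. -/
theorem exists_monic_polyEval_eq_zero :
    ∃ g : Polynomial (MvPolynomial (Fin n) ℝ), g.Monic ∧ g.natDegree ≤ rank E ∧
      ∀ c, polyEval (b.equivFun.symm c) (g.map (eval c)) = 0 := by
  set R := MvPolynomial (Fin n) ℝ
  set K := FractionRing R
  have hinj : Function.Injective (algebraMap R K) := IsFractionRing.injective R K
  set M := (genericMul b).map (algebraMap R K) with hM
  set e := algebraMap R K ∘ genericOne b with he
  have hmap : ∀ p : Polynomial R, (fun j => algebraMap R K
      ((Polynomial.aeval (genericMul b) p).mulVec (genericOne b) j)) =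
      (Polynomial.aeval M (p.map (algebraMap R K))).mulVec e := by
    intro p
    ext1 j
    rw [RingHom.map_mulVec, Matrix.map_aeval]
  -- Independence over `K` would persist at some real point, where `rank E + 1` powers are
  -- dependent.
  have hdep : ¬ LinearIndependent K fun i : Fin (rank E + 1) =>
      (Polynomial.aeval M (Polynomial.X ^ (i : ℕ) : Polynomial K)).mulVec e := by
    intro h
    obtain ⟨c, hc⟩ := MvPolynomial.exists_linearIndependent_eval
      (w := fun (i : Fin (rank E + 1)) => (Polynomial.aeval (genericMul b)
        (Polynomial.X ^ (i : ℕ) : Polynomial R)).mulVec (genericOne b)) (by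
        convert h using 2 with i
        rw [hmap, Polynomial.map_pow, Polynomial.map_X])
    exact not_linearIndependent_polyEval_X_pow _
      ((linearIndependent_eval_genericPow_iff b c (rank E + 1)).mp hc)
  rw [Fintype.linearIndependent_iff] at hdep
  push Not at hdep
  obtain ⟨a, ha, i₀, hi₀⟩ := hdep
  set q : Polynomial K := ∑ i : Fin (rank E + 1), a i • Polynomial.X ^ (i : ℕ) with hq
  have hq0 : q ≠ 0 := by
    intro h
    apply hi₀
    have h2 : q.coeff (i₀ : ℕ) = a i₀ := by
      rw [hq, Polynomial.finsetSum_coeff, Finset.sum_eq_single i₀]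
      · simp
      · intro j _ hj
        have : (i₀ : ℕ) ≠ j := fun h => hj (Fin.ext h.symm)
        simp [Polynomial.coeff_X_pow, this]
      · simp
    rw [← h2, h, Polynomial.coeff_zero]
  have hqdeg : q.natDegree ≤ rank E := by
    refine Polynomial.natDegree_sum_le_of_forall_le _ _ fun i _ => ?_
    exact (Polynomial.natDegree_smul_le _ _).trans
      ((Polynomial.natDegree_X_pow_le _).trans (by omega))
  have hqe : (Polynomial.aeval M q).mulVec e = 0 := by
    rw [hq, map_sum, Matrix.sum_mulVec, ← ha]
    refine Finset.sum_congr rfl fun i _ => ?_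
    rw [map_smul, Matrix.smul_mulVec]
  -- `q` has small degree but fractional coefficients; `χ` is monic over `R` and also annihilates,
  -- by Cayley–Hamilton. Their gcd has both virtues.
  set χ := (genericMul b).charpoly with hχ
  have hχe : (Polynomial.aeval M (χ.map (algebraMap R K))).mulVec e = 0 := by
    rw [← hmap, hχ, Matrix.aeval_self_charpoly]
    simp only [Matrix.zero_mulVec, Pi.zero_apply, map_zero]
    rfl
  classical
  set d := EuclideanDomain.gcd q (χ.map (algebraMap R K)) with hd
  have hde : (Polynomial.aeval M d).mulVec e = 0 := by
    rw [hd, EuclideanDomain.gcd_eq_gcd_ab, mul_comm q, mul_comm (χ.map _), map_add, map_mul,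
      map_mul, Matrix.add_mulVec, ← Matrix.mulVec_mulVec, ← Matrix.mulVec_mulVec, hqe, hχe,
      Matrix.mulVec_zero, Matrix.mulVec_zero, add_zero]
  have hd0 : d ≠ 0 := fun h => hq0 (EuclideanDomain.gcd_eq_zero_iff.mp h).1
  -- Gauss's lemma: over the integrally closed `R`, a divisor in `K[X]` of a monic polynomial is, up
  -- to a constant, defined over `R`.
  obtain ⟨g, hg⟩ := IsIntegrallyClosed.eq_map_mul_C_of_dvd K (Matrix.charpoly_monic _)
    (EuclideanDomain.gcd_dvd_right q (χ.map (algebraMap R K)))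
  rw [← hd] at hg
  have hlc : d.leadingCoeff ≠ 0 := Polynomial.leadingCoeff_ne_zero.mpr hd0
  have hgm : g.Monic := by
    have h := congrArg Polynomial.leadingCoeff hg
    rw [Polynomial.leadingCoeff_mul, Polynomial.leadingCoeff_C] at h
    exact Polynomial.monic_of_injective hinj (mul_right_cancel₀ hlc (h.trans (one_mul _).symm))
  refine ⟨g, hgm, ?_, fun c => ?_⟩
  · have h1 : g.natDegree = d.natDegree := by
      rw [← hg, Polynomial.natDegree_mul_C hlc, Polynomial.natDegree_map_eq_of_injective hinj]
    rw [h1]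
    exact (Polynomial.natDegree_le_of_dvd (EuclideanDomain.gcd_dvd_left _ _) hq0).trans hqdeg
  · have hge : (Polynomial.aeval M (g.map (algebraMap R K))).mulVec e = 0 := by
      rw [← hg, mul_comm, map_mul, Polynomial.aeval_C, ← Matrix.mulVec_mulVec,
        Algebra.algebraMap_eq_smul_one, Matrix.smul_mulVec, Matrix.one_mulVec] at hde
      exact (smul_eq_zero.mp hde).resolve_left hlc
    rw [← hmap] at hge
    have hg0 : (Polynomial.aeval (genericMul b) g).mulVec (genericOne b) = 0 :=
      funext fun j => hinj ((congrFun hge j).trans (map_zero _).symm)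
    have h := eval_aeval_genericMul b c g
    rw [hg0] at h
    apply b.equivFun.injective
    rw [← h, map_zero]
    ext j
    simp

end GenericEuclidean

end EuclideanJordanAlgebra

/-! ### Semialgebraic sets and density of nonvanishing loci. -/

section Semialgebraic

open MvPolynomial

variable {σ : Type*}

theorem IsSemialgebraicSet.setOf_eval_eq_zero (p : MvPolynomial σ ℝ) :
    IsSemialgebraicSet {z : σ → ℝ | eval z p = 0} :=
  ⟨{({p}, ∅)}, by simp⟩

theorem IsSemialgebraicSet.setOf_eval_neg (p : MvPolynomial σ ℝ) :
    IsSemialgebraicSet {z : σ → ℝ | eval z p < 0} :=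
  ⟨{(∅, {p})}, by simp⟩

theorem IsSemialgebraicSet.univ : IsSemialgebraicSet (Set.univ : Set (σ → ℝ)) :=
  ⟨{(∅, ∅)}, by simp⟩

theorem IsSemialgebraicSet.union {S T : Set (σ → ℝ)} (hS : IsSemialgebraicSet S)
    (hT : IsSemialgebraicSet T) : IsSemialgebraicSet (S ∪ T) := by
  classical
  obtain ⟨C, rfl⟩ := hS
  obtain ⟨D, rfl⟩ := hT
  exact ⟨C ∪ D, by rw [Finset.set_biUnion_union]⟩

theorem IsSemialgebraicSet.inter {S T : Set (σ → ℝ)} (hS : IsSemialgebraicSet S)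
    (hT : IsSemialgebraicSet T) : IsSemialgebraicSet (S ∩ T) := by
  classical
  obtain ⟨C, rfl⟩ := hS
  obtain ⟨D, rfl⟩ := hT
  refine ⟨(C ×ˢ D).image fun p => (p.1.1 ∪ p.2.1, p.1.2 ∪ p.2.2), ?_⟩
  ext z
  simp only [Set.mem_inter_iff, Set.mem_iUnion, Set.mem_ofPred_eq, Finset.mem_image,
    Finset.mem_product, exists_prop]
  constructor
  · rintro ⟨⟨c, hc, h1, h2⟩, ⟨d, hd, h3, h4⟩⟩
    refine ⟨_, ⟨(c, d), ⟨hc, hd⟩, rfl⟩, fun p hp => ?_, fun p hp => ?_⟩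
    · exact (Finset.mem_union.mp hp).elim (h1 p) (h3 p)
    · exact (Finset.mem_union.mp hp).elim (h2 p) (h4 p)
  · rintro ⟨_, ⟨⟨c, d⟩, ⟨hc, hd⟩, rfl⟩, h1, h2⟩
    exact ⟨⟨c, hc, fun p hp => h1 p (Finset.mem_union_left _ hp),
        fun p hp => h2 p (Finset.mem_union_left _ hp)⟩,
      ⟨d, hd, fun p hp => h1 p (Finset.mem_union_right _ hp),
        fun p hp => h2 p (Finset.mem_union_right _ hp)⟩⟩

theorem IsSemialgebraicSet.setOf_eval_nonpos (p : MvPolynomial σ ℝ) :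
    IsSemialgebraicSet {z : σ → ℝ | eval z p ≤ 0} := by
  have h : {z : σ → ℝ | eval z p ≤ 0} = {z | eval z p < 0} ∪ {z | eval z p = 0} := by
    ext z
    exact le_iff_lt_or_eq (a := eval z p) (b := 0)
  rw [h]
  exact (setOf_eval_neg p).union (setOf_eval_eq_zero p)

theorem IsSemialgebraicSet.setOf_forall_mem {ι : Type*} (s : Finset ι) (S : ι → Set (σ → ℝ))
    (hS : ∀ i ∈ s, IsSemialgebraicSet (S i)) : IsSemialgebraicSet {z | ∀ i ∈ s, z ∈ S i} := by
  classical
  induction s using Finset.induction_on with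
  | empty => simpa using IsSemialgebraicSet.univ
  | insert a s _ ih =>
    have h : {z | ∀ i ∈ insert a s, z ∈ S i} = S a ∩ {z | ∀ i ∈ s, z ∈ S i} := by
      ext z
      simp
    rw [h]
    exact (hS a (Finset.mem_insert_self a s)).inter
      (ih fun i hi => hS i (Finset.mem_insert_of_mem hi))

/-- The ordered roots of a monic polynomial are a semialgebraic function of its coefficients. -/
theorem isSemialgebraicSet_setOf_antitone_map_eq_prod {n r : ℕ}
    (g : Polynomial (MvPolynomial (Fin n) ℝ)) :
    IsSemialgebraicSet {z : Fin n ⊕ Fin r → ℝ | Antitone (fun i => z (Sum.inr i)) ∧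
      g.map (eval fun i => z (Sum.inl i)) =
        ∏ i, (Polynomial.X - Polynomial.C (z (Sum.inr i)))} := by
  -- Equality of the two polynomials at `z` is the vanishing at `z` of the finitely many nonzero
  -- coefficients of `G`.
  set G : Polynomial (MvPolynomial (Fin n ⊕ Fin r) ℝ) :=
    g.map (rename Sum.inl).toRingHom - ∏ i : Fin r, (Polynomial.X - Polynomial.C (X (Sum.inr i)))
    with hG
  have hGz : ∀ z : Fin n ⊕ Fin r → ℝ, G.map (eval z) =
      g.map (eval fun i => z (Sum.inl i)) -
        ∏ i, (Polynomial.X - Polynomial.C (z (Sum.inr i))) := by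
    intro z
    have h : (eval z).comp (rename (R := ℝ) (Sum.inl : Fin n → Fin n ⊕ Fin r)).toRingHom =
        eval fun i => z (Sum.inl i) := by
      ext <;> simp
    rw [hG, Polynomial.map_sub, Polynomial.map_map, h, Polynomial.map_prod]
    simp
  have hset : {z : Fin n ⊕ Fin r → ℝ | Antitone (fun i => z (Sum.inr i)) ∧
      g.map (eval fun i => z (Sum.inl i)) =
        ∏ i, (Polynomial.X - Polynomial.C (z (Sum.inr i)))} =
      {z | ∀ p ∈ Finset.univ.filter fun p : Fin r × Fin r => p.1 ≤ p.2,
        z ∈ {z | eval z (X (Sum.inr p.2) - X (Sum.inr p.1)) ≤ 0}} ∩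
      {z | ∀ k ∈ G.support, z ∈ {z | eval z (G.coeff k) = 0}} := by
    ext z
    simp only [Set.mem_ofPred_eq, Set.mem_inter_iff, Finset.mem_filter, Finset.mem_univ, true_and,
      map_sub, eval_X, sub_nonpos]
    refine and_congr ⟨fun h p hp => h hp, fun h i j hij => h (i, j) hij⟩ ?_
    rw [← sub_eq_zero, ← hGz]
    constructor
    · intro h k _
      rw [← Polynomial.coeff_map, h, Polynomial.coeff_zero]
    · intro h
      ext k
      rw [Polynomial.coeff_map, Polynomial.coeff_zero]
      by_cases hk : k ∈ G.support
      · exact h k hk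
      · rw [Polynomial.notMem_support_iff.mp hk, map_zero]
  rw [hset]
  exact (IsSemialgebraicSet.setOf_forall_mem _ _ fun _ _ => .setOf_eval_nonpos _).inter
    (IsSemialgebraicSet.setOf_forall_mem _ _ fun _ _ => .setOf_eval_eq_zero _)

/-- A ball for the sup norm is a product of infinite sets, on which a nonzero polynomial cannot
vanish identically. -/
theorem MvPolynomial.dense_setOf_eval_ne_zero {n : ℕ} {D : MvPolynomial (Fin n) ℝ} (hD : D ≠ 0) :
    Dense {c | eval c D ≠ 0} := by
  rw [dense_iff_inter_open]
  rintro U hU ⟨c₀, hc₀⟩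
  obtain ⟨ε, hε, hball⟩ := Metric.isOpen_iff.mp hU c₀ hc₀
  by_contra hempty
  rw [Set.not_nonempty_iff_eq_empty, Set.eq_empty_iff_forall_notMem] at hempty
  refine hD (MvPolynomial.funext_set (fun i => Metric.ball (c₀ i) ε) (fun i => ?_) fun c hc => ?_)
  · rw [Real.ball_eq_Ioo]
    exact Set.Ioo_infinite (by linarith)
  · rw [← ball_pi _ hε] at hc
    have := hempty c
    rw [map_zero]
    by_contra h
    exact this ⟨hball hc, h⟩

end Semialgebraic

/-! ### Limits of frames are frames. -/

section Compactness

/-- In a finite-dimensional unital algebra with symmetric multiplications, the elements that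
decompose along a complete family of `r` orthogonal idempotents form a closed set. -/
theorem isClosed_setOf_eq_sum_smul_idempotents {V : Type*} [NormedAddCommGroup V]
    [InnerProductSpace ℝ V] [FiniteDimensional ℝ V] (m : V →ₗ[ℝ] V →ₗ[ℝ] V) (e : V)
    (he : ∀ x, m e x = x) (hm : ∀ x y z, inner ℝ (m z x) y = inner ℝ z (m x y)) (r : ℕ) :
    IsClosed {x : V | ∃ (u : Fin r → ℝ) (v : Fin r → V), Antitone u ∧ (∀ i, v i ≠ 0) ∧
      (∀ i, m (v i) (v i) = v i) ∧ (∀ i j, i ≠ j → m (v i) (v j) = 0) ∧ ∑ i, v i = e ∧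
      x = ∑ i, u i • v i} := by
  have : ProperSpace V := FiniteDimensional.proper ℝ V
  let B : V →L[ℝ] V →L[ℝ] V := LinearMap.toContinuousLinearMap
    ((LinearMap.toContinuousLinearMap : (V →ₗ[ℝ] V) ≃ₗ[ℝ] V →L[ℝ] V).toLinearMap ∘ₗ m)
  have hmul : Continuous fun p : V × V => m p.1 p.2 := B.continuous₂
  have hbound : ∀ y z : V, ‖m y z‖ ≤ ‖B‖ * ‖y‖ * ‖z‖ := fun y z => B.le_opNorm₂ y z
  have hidem : ∀ v : V, m v v = v → ‖v‖ ≤ ‖e‖ := by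
    intro v hv
    -- Symmetry gives `‖v‖ ^ 2 = ⟪e, v⟫`, so Cauchy–Schwarz bounds every idempotent by `‖e‖`.
    have h : inner ℝ v v = inner ℝ e v := by
      have := hm v v e
      rwa [he, hv] at this
    have h1 := real_inner_le_norm e v
    rw [← h, real_inner_self_eq_norm_sq] at h1
    nlinarith [norm_nonneg v, norm_nonneg e]
  -- Nonzero idempotents stay away from `0`, so none disappears in the limit.
  have hlow : ∀ v : V, v ≠ 0 → m v v = v → 1 ≤ ‖B‖ * ‖v‖ := by
    intro v hv0 hv
    have h := hbound v v
    rw [hv] at h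
    exact le_of_mul_le_mul_right (by rwa [one_mul]) (norm_pos_iff.mpr hv0)
  refine IsSeqClosed.isClosed fun xs x hxs hx => ?_
  choose us vs hu hv0 hvi hvo h1 hxe using hxs
  obtain ⟨R, hR⟩ := hx.norm.bddAbove_range
  have hRm : ∀ k, ‖xs k‖ ≤ R := fun k => hR ⟨k, rfl⟩
  -- Each coefficient is an eigenvalue of multiplication by `xs k`, hence bounded along the
  -- convergent sequence.
  have hub : ∀ k i, ‖us k i‖ ≤ ‖B‖ * R := by
    intro k i
    have h : m (xs k) (vs k i) = us k i • vs k i := by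
      rw [hxe k, map_sum, LinearMap.sum_apply, Finset.sum_eq_single i]
      · rw [map_smul, LinearMap.smul_apply, hvi]
      · intro j _ hj
        rw [map_smul, LinearMap.smul_apply, hvo k j i hj, smul_zero]
      · simp
    have h2 := hbound (xs k) (vs k i)
    rw [h, norm_smul] at h2
    exact (le_of_mul_le_mul_right h2 (norm_pos_iff.mpr (hv0 k i))).trans
      (mul_le_mul_of_nonneg_left (hRm k) (norm_nonneg B))
  have hR0 : 0 ≤ ‖B‖ * R := mul_nonneg (norm_nonneg B) ((norm_nonneg _).trans (hRm 0))
  obtain ⟨⟨u, v⟩, -, φ, hφ, hlim⟩ := ((isCompact_closedBall (0 : Fin r → ℝ) (‖B‖ * R)).prod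
    (isCompact_closedBall (0 : Fin r → V) ‖e‖)).tendsto_subseq
    (x := fun k => (us k, vs k)) fun k =>
      ⟨mem_closedBall_zero_iff.mpr ((pi_norm_le_iff_of_nonneg hR0).mpr (hub k)),
        mem_closedBall_zero_iff.mpr ((pi_norm_le_iff_of_nonneg (norm_nonneg _)).mpr
          fun i => hidem _ (hvi k i))⟩
  have hul : ∀ i, Filter.Tendsto (fun k => us (φ k) i) Filter.atTop (nhds (u i)) :=
    tendsto_pi_nhds.mp ((Prod.tendsto_iff _ _).mp hlim).1
  have hvl : ∀ i, Filter.Tendsto (fun k => vs (φ k) i) Filter.atTop (nhds (v i)) :=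
    tendsto_pi_nhds.mp ((Prod.tendsto_iff _ _).mp hlim).2
  have hmull : ∀ i j, Filter.Tendsto (fun k => m (vs (φ k) i) (vs (φ k) j)) Filter.atTop
      (nhds (m (v i) (v j))) := fun i j =>
    (hmul.tendsto (v i, v j)).comp ((hvl i).prodMk_nhds (hvl j))
  refine ⟨u, v, fun i j hij => ?_, fun i hi => ?_, fun i => ?_, fun i j hij => ?_, ?_, ?_⟩
  · exact le_of_tendsto_of_tendsto' (hul j) (hul i) fun k => hu (φ k) hij
  · have h := ge_of_tendsto' ((hvl i).norm.const_mul ‖B‖) fun k => hlow _ (hv0 _ i) (hvi _ i)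
    rw [hi, norm_zero, mul_zero] at h
    exact absurd h (by norm_num)
  · exact tendsto_nhds_unique (hmull i i) (by simpa only [hvi] using hvl i)
  · exact tendsto_nhds_unique (hmull i j)
      (by simpa only [hvo _ i j hij] using tendsto_const_nhds)
  · exact tendsto_nhds_unique (tendsto_finsetSum _ fun i _ => hvl i)
      (by simpa only [h1] using tendsto_const_nhds)
  · refine tendsto_nhds_unique (hx.comp hφ.tendsto_atTop) ?_
    simp only [Function.comp_def, hxe]
    exact tendsto_finsetSum _ fun i _ => (hul i).smul (hvl i)

end Compactness

/-- The product determines the multiset of roots, and a multiset has only one nonincreasing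
enumeration. -/
theorem Antitone.eq_of_prod_X_sub_C_eq {r : ℕ} {u u' : Fin r → ℝ} (hu : Antitone u)
    (hu' : Antitone u') (h : ∏ i, (Polynomial.X - Polynomial.C (u i)) =
      ∏ i, (Polynomial.X - Polynomial.C (u' i))) : u = u' := by
  have hroots : ∀ w : Fin r → ℝ, (∏ i, (Polynomial.X - Polynomial.C (w i))).roots =
      (List.ofFn w : Multiset ℝ) := by
    intro w
    rw [← Polynomial.roots_multiset_prod_X_sub_C (List.ofFn w : Multiset ℝ)]
    simp [List.map_ofFn, List.prod_ofFn]
  have hp := congrArg Polynomial.roots h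
  rw [hroots, hroots, Multiset.coe_eq_coe] at hp
  exact List.ofFn_injective
    (hp.eq_of_pairwise' hu.sortedGE_ofFn.pairwise hu'.sortedGE_ofFn.pairwise)

namespace EuclideanJordanAlgebra

open MvPolynomial

/-! ### The characteristic polynomial and existence of frames. -/

section Characteristic

variable {E : Type*} [NonAssocCommRing E] [Module ℝ E] [FiniteDimensional ℝ E]
  [EuclideanJordanAlgebra E] {n : ℕ} (b : Basis (Fin n) ℝ E)

/-- The characteristic polynomial: its coefficients are polynomial in `x`, and its roots are the
coefficients of `x` in any maximal family of orthogonal idempotents. -/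
theorem exists_polynomial_map_eq_prod :
    ∃ g : Polynomial (MvPolynomial (Fin n) ℝ), ∀ (u : Fin (rank E) → ℝ) (v : Fin (rank E) → E),
      Antitone u → IsOrthogonalIdempotents v →
        g.map (eval (b.equivFun (∑ i, u i • v i))) =
          ∏ i, (Polynomial.X - Polynomial.C (u i)) := by
  obtain ⟨g, hgm, hgd, hg⟩ := exists_monic_polyEval_eq_zero b
  -- Every `u i` is a root of the specialized `g`; being distinct, they exhaust its degree, at most
  -- `rank E`.
  have hinj : ∀ (u : Fin (rank E) → ℝ) (v : Fin (rank E) → E), Function.Injective u →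
      IsOrthogonalIdempotents v → g.map (eval (b.equivFun (∑ i, u i • v i))) =
        ∏ i, (Polynomial.X - Polynomial.C (u i)) := by
    intro u v hu hv
    have h0 := hg (b.equivFun (∑ i, u i • v i))
    rw [LinearEquiv.symm_apply_apply, polyEval_sum_smul hv hv.sum_eq_one] at h0
    have hroot := Fintype.linearIndependent_iff.mp hv.linearIndependent _ h0
    refine Polynomial.eq_of_monic_of_dvd_of_natDegree_le
      (Polynomial.monic_prod_X_sub_C u Finset.univ) (hgm.map _) ?_ ?_
    · refine Finset.prod_dvd_of_coprime (fun i _ j _ hij => ?_) fun i _ => ?_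
      · exact Polynomial.pairwise_coprime_X_sub_C hu hij
      · exact Polynomial.dvd_iff_isRoot.mpr (hroot i)
    · rw [Polynomial.natDegree_finsetProd_X_sub_C_eq_card, Finset.card_fin, hgm.natDegree_map]
      exact hgd
  refine ⟨g, fun u v hu hv => Polynomial.funext fun t => ?_⟩
  -- For `ε > 0` the coefficients `u i - ε * i` of `x - ε • y` are strictly decreasing, so the
  -- distinct case applies; then `ε → 0`.
  set y : E := ∑ i : Fin (rank E), ((i : ℕ) : ℝ) • v i with hy
  have heval : ∀ c : Fin n → ℝ, (g.map (eval c)).eval t = eval c (g.eval (C t)) := by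
    intro c
    rw [Polynomial.eval_map, Polynomial.eval, Polynomial.hom_eval₂]
    simp
  have hF : Continuous fun ε : ℝ =>
      (g.map (eval (b.equivFun (∑ i, u i • v i) - ε • b.equivFun y))).eval t := by
    simp only [heval]
    exact (MvPolynomial.continuous_eval _).comp (by fun_prop)
  have hG : Continuous fun ε : ℝ => ∏ i : Fin (rank E), (t - (u i - ε * (i : ℕ))) := by
    fun_prop
  have hsub : Set.Ioi (0 : ℝ) ⊆ {ε : ℝ |
      (g.map (eval (b.equivFun (∑ i, u i • v i) - ε • b.equivFun y))).eval t =
        ∏ i : Fin (rank E), (t - (u i - ε * (i : ℕ)))} := by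
    intro ε hε
    have hanti : StrictAnti fun i : Fin (rank E) => u i - ε * ((i : ℕ) : ℝ) := by
      intro i j hij
      have h1 := hu hij.le
      have h2 : ((i : ℕ) : ℝ) < ((j : ℕ) : ℝ) := Nat.cast_lt.mpr hij
      have h3 := mul_lt_mul_of_pos_left h2 (Set.mem_Ioi.mp hε)
      show u j - _ < u i - _
      linarith
    have h := congrArg (Polynomial.eval t) (hinj _ v hanti.injective hv)
    simp only [sub_smul, mul_smul, Finset.sum_sub_distrib, ← Finset.smul_sum, map_sub, map_smul,
      ← hy] at h
    rw [Set.mem_ofPred_eq, h, Polynomial.eval_prod]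
    simp
  have h0 := (isClosed_eq hF hG).closure_subset_iff.mpr hsub
    (by rw [closure_Ioi]; exact Set.self_mem_Ici : (0 : ℝ) ∈ closure (Set.Ioi 0))
  simp only [Set.mem_ofPred_eq, zero_smul, sub_zero, zero_mul] at h0
  rw [h0, Polynomial.eval_prod]
  simp

theorem dense_setOf_exists_isOrderedEigenvalues [TopologicalSpace E] [IsTopologicalAddGroup E]
    [ContinuousSMul ℝ E] [T2Space E] : Dense {x : E | ∃ u, IsOrderedEigenvalues x u} := by
  obtain ⟨D, hD, h⟩ := exists_ne_zero_linearIndependent (finBasis ℝ E)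
  have hd := (finBasis ℝ E).equivFun.symm.surjective.denseRange.dense_image
    (finBasis ℝ E).equivFun.symm.toLinearMap.continuous_of_finiteDimensional
    (MvPolynomial.dense_setOf_eval_ne_zero hD)
  refine hd.mono ?_
  rintro _ ⟨c, hc, rfl⟩
  obtain ⟨u, v, hu, hv, h1, hx⟩ := exists_strictAnti_of_linearIndependent (h c hc)
  exact ⟨u, hu.antitone, v, hv, h1, hx⟩

/-- The spectral theorem, with eigenvalues counted with multiplicity. -/
theorem exists_isOrderedEigenvalues (x : E) : ∃ u, IsOrderedEigenvalues x u := by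
  let _ : NormedAddCommGroup E := InnerProductSpace.Core.toNormedAddCommGroup (𝕜 := ℝ)
  let _ : InnerProductSpace ℝ E := InnerProductSpace.ofCore (toInnerCore (E := E)).toCore
  -- The elements admitting a frame form a closed set, and they are dense.
  have hcl := isClosed_setOf_eq_sum_smul_idempotents (LinearMap.mul ℝ E) 1 one_mul
    (fun x y z => inner_mul_comm x y z) (rank E)
  have hsub := (hcl.closure_subset_iff (s := {y : E | ∃ u, IsOrderedEigenvalues y u})).mpr
    fun y ⟨u, hu, v, hv, h1, hy⟩ => ⟨u, v, hu, hv.ne_zero, hv.idem, hv.ortho, h1, hy⟩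
  obtain ⟨u, v, hu, h0, hi, ho, h1, hx⟩ := hsub (dense_setOf_exists_isOrderedEigenvalues x)
  exact ⟨u, hu, v, ⟨h0, hi, ho⟩, h1, hx⟩

end Characteristic

end EuclideanJordanAlgebra

namespace EuclideanJordanAlgebra

/-! ### Properties of the eigenvalue map and the determinant. -/

section EigenvalueMap

variable {E : Type*} [NonAssocCommRing E] [Module ℝ E] [FiniteDimensional ℝ E]
  [EuclideanJordanAlgebra E]

theorem isOrderedEigenvalues_eigenvalueMap (x : E) : IsOrderedEigenvalues x (eigenvalueMap x) :=
  Classical.epsilon_spec (exists_isOrderedEigenvalues x)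

theorem IsOrderedEigenvalues.unique {x : E} {u u' : Fin (rank E) → ℝ}
    (hu : IsOrderedEigenvalues x u) (hu' : IsOrderedEigenvalues x u') : u = u' := by
  obtain ⟨g, hg⟩ := exists_polynomial_map_eq_prod (finBasis ℝ E)
  obtain ⟨ha, v, hv, -, hx⟩ := hu
  obtain ⟨ha', v', hv', -, hx'⟩ := hu'
  refine ha.eq_of_prod_X_sub_C_eq ha' ?_
  rw [← hg u v ha hv, ← hg u' v' ha' hv', ← hx, ← hx']

theorem isOrderedEigenvalues_iff (x : E) (u : Fin (rank E) → ℝ) :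
    IsOrderedEigenvalues x u ↔ u = eigenvalueMap x :=
  ⟨fun h => h.unique (isOrderedEigenvalues_eigenvalueMap x),
    fun h => h ▸ isOrderedEigenvalues_eigenvalueMap x⟩

/-- A frame sums to `1`, so a frame for `x` also serves `x - t • 1`. -/
theorem eigenvalueMap_sub_smul_one (x : E) (t : ℝ) :
    eigenvalueMap (x - t • (1 : E)) = fun i => eigenvalueMap x i - t := by
  symm
  rw [← isOrderedEigenvalues_iff]
  obtain ⟨ha, v, hv, h1, hx⟩ := isOrderedEigenvalues_eigenvalueMap x
  refine ⟨fun i j hij => sub_le_sub_right (ha hij) t, v, hv, h1, ?_⟩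
  simp only [sub_smul, Finset.sum_sub_distrib, ← Finset.smul_sum, h1]
  rw [← hx]

/-- Up to the sign `(-1) ^ rank E`, the condition on `det` equates two monic polynomials in `t`,
whose ordered roots then agree. -/
theorem eq_eigenvalueMap_iff (x : E) (u : Fin (rank E) → ℝ) :
    u = eigenvalueMap x ↔
      Antitone u ∧ ∀ t : ℝ, det (x - t • (1 : E)) = ∏ i, (u i - t) := by
  have hdet : ∀ t : ℝ, det (x - t • (1 : E)) = ∏ i, (eigenvalueMap x i - t) := fun t => by
    rw [det, eigenvalueMap_sub_smul_one]
  constructor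
  · rintro rfl
    exact ⟨(isOrderedEigenvalues_eigenvalueMap x).1, hdet⟩
  · rintro ⟨ha, h⟩
    refine ha.eq_of_prod_X_sub_C_eq (isOrderedEigenvalues_eigenvalueMap x).1
      (Polynomial.funext fun t => ?_)
    have hneg : ∀ w : Fin (rank E) → ℝ,
        (∏ i, (Polynomial.X - Polynomial.C (w i))).eval t = (-1) ^ rank E * ∏ i, (w i - t) := by
      intro w
      rw [← Fin.prod_const, ← Finset.prod_mul_distrib, Polynomial.eval_prod]
      exact Finset.prod_congr rfl fun i _ => by simp
    rw [hneg, hneg, ← h, hdet]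

/-- A point is on the graph exactly when its second component lists in order the roots of `g`
specialized at the first. -/
theorem isSemialgebraicMap_eigenvalueMap :
    IsSemialgebraicMap (eigenvalueMap : E → Fin (rank E) → ℝ) := by
  intro n b
  obtain ⟨g, hg⟩ := exists_polynomial_map_eq_prod b
  have h := isSemialgebraicSet_setOf_antitone_map_eq_prod (r := rank E) g
  unfold IsSemialgebraicFun
  convert h using 1
  ext z
  obtain ⟨ha, v, hv, -, hx⟩ :=
    isOrderedEigenvalues_eigenvalueMap (b.equivFun.symm fun i => z (Sum.inl i))
  have hgx := hg _ v ha hv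
  rw [← hx, LinearEquiv.apply_symm_apply] at hgx
  simp only [Set.mem_ofPred_eq, hgx]
  constructor
  · intro hz
    rw [← hz] at ha ⊢
    exact ⟨ha, rfl⟩
  · rintro ⟨hz, he⟩
    exact hz.eq_of_prod_X_sub_C_eq ha he.symm

theorem isPolynomialFun_det : IsPolynomialFun (det : E → ℝ) := by
  intro n b
  obtain ⟨g, hg⟩ := exists_polynomial_map_eq_prod b
  refine ⟨MvPolynomial.C ((-1) ^ rank E) * g.coeff 0, fun c => ?_⟩
  obtain ⟨ha, v, hv, -, hx⟩ := isOrderedEigenvalues_eigenvalueMap (b.equivFun.symm c)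
  have hgx := hg _ v ha hv
  rw [← hx, LinearEquiv.apply_symm_apply] at hgx
  rw [map_mul, MvPolynomial.eval_C, ← Polynomial.coeff_map, hgx, Polynomial.coeff_zero_eq_eval_zero,
    Polynomial.eval_prod, ← Fin.prod_const, ← Finset.prod_mul_distrib, det]
  exact Finset.prod_congr rfl fun i _ => by simp

end EigenvalueMap

end EuclideanJordanAlgebra

theorem mainTheorem3 (E : Type*) [NonAssocCommRing E] [Module ℝ E] [FiniteDimensional ℝ E]
    [EuclideanJordanAlgebra E] :
    -- the ordered eigenvalue map is well defined
    (∀ (x : E) (u : Fin (EuclideanJordanAlgebra.rank E) → ℝ),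
      EuclideanJordanAlgebra.IsOrderedEigenvalues x u ↔
        u = EuclideanJordanAlgebra.eigenvalueMap x) ∧
    -- it is semialgebraic
    IsSemialgebraicMap
      (EuclideanJordanAlgebra.eigenvalueMap : E → Fin (EuclideanJordanAlgebra.rank E) → ℝ) ∧
    -- the determinant is a polynomial function
    IsPolynomialFun (EuclideanJordanAlgebra.det : E → ℝ) ∧
    -- description of the graph
    {p : E × (Fin (EuclideanJordanAlgebra.rank E) → ℝ) |
        p.2 = EuclideanJordanAlgebra.eigenvalueMap p.1} =
      {p : E × (Fin (EuclideanJordanAlgebra.rank E) → ℝ) |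
        Antitone p.2 ∧ ∀ t : ℝ,
          EuclideanJordanAlgebra.det (p.1 - t • (1 : E)) = ∏ i, (p.2 i - t)} := by
  refine ⟨EuclideanJordanAlgebra.isOrderedEigenvalues_iff,
    EuclideanJordanAlgebra.isSemialgebraicMap_eigenvalueMap,
    EuclideanJordanAlgebra.isPolynomialFun_det, ?_⟩
  ext p
  exact EuclideanJordanAlgebra.eq_eigenvalueMap_iff p.1 p.2
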